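/- Let $\mathcal A$ be an abelian category (with small Hom-sets) that is complete and cocomplete and in which the subobjects of every object form a set. A preradical of $\mathcal A$ is a subobject $\tau: T\hookrightarrow 1_{\mathcal A}$ of the identity functor in $\mathrm{Fun}(\mathcal A,\mathcal A)$; the collection $Pr(\mathcal A)$ of preradicals is ordered as subobjects of $1_{\mathcal A}$. For preradicals $\sigma: S\hookrightarrow 1_{\mathcal A}$ and $\tau: T\hookrightarrow 1_{\mathcal A}$, with cokernel $\sigma^*:1_{\mathcal A}\twoheadrightarrow S^*$, let $(\sigma:\tau)$ be the preradical obtained by pulling back $\tau S^*: T\circ S^*\hookrightarrow S^*$ along $\sigma^*$. A preradical $\sigma$ is a radical if $(\sigma:\sigma)=\sigma$; $Rad(\mathcal A)\subseteq Pr(\mathcal A)$ denotes the collection of radicals with the induced order. For an object $M$, let $\omega_{1_M}$ be the kernel of the natural transformation $1_{\mathcal A}\to M^{\mathrm{Hom}(-,M)}$ whose value at $L$ is the morphism $L\to M^{\mathrm{Hom}(L,M)}$ with component $f$ at each $f\in \mathrm{Hom}(L,M)$. (1) For every preradical $\tau$ of $\mathcal A$, the meet (greatest lower bound) $\bigwedge\{\omega_{1_M}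 : M\in\mathcal A,\ \tau_M=0\}$ exists in $Pr(\mathcal A)$, and $\tau$ is a radical if and only if $$\tau=\bigwedge_{M\in\mathcal A,\ \tau_M=0}\omega_{1_M}.$$ (2) For every collection (not necessarily a set) of radicals of $\mathcal A$, the meet exists in $Pr(\mathcal A)$ and is a radical. (3) $Rad(\mathcal A)$ is a complete lattice: every collection (not necessarily a set) of radicals has a least upper bound and a greatest lower bound in $Rad(\mathcal A)$. -/

import Mathlib

open CategoryTheory CategoryTheory.Limits

universe v u

noncomputable section

namespace PreradicalLattice

/-- The partially ordered collection `Pr(A)` of preradicals of an abelian category `A`: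
subobjects (equivalence classes of monomorphisms) of the identity functor in `A ⥤ A`.
It carries Mathlib's order on subobjects. -/
abbrev Pr (A : Type u) [Category.{v} A] [Abelian A] : Type (max u v) :=
  Subobject (𝟭 A)

section

variable {A : Type u} [Category.{v} A] [Abelian A]

/-- A representing monomorphism `T ⟶ 𝟭 A` of a preradical. -/
abbrev rep (τ : Pr A) : Abelian.Preradical A :=
  Subobject.representative.obj τ

/-- The coproduct `(σ : τ)` of two preradicals: the class of the pullback of
`τS* : T ∘ S* ⟶ S*` along `σ* = coker σ : 𝟭 A ⟶ S*`. -/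
def prCoprod (σ τ : Pr A) : Pr A :=
  Subobject.mk ((rep σ).colon (rep τ)).ι

/-- A preradical `σ` is a radical if `(σ : σ) = σ`. -/
def IsRad (σ : Pr A) : Prop :=
  prCoprod σ σ = σ

/-- The class of objects `M` with `τ_M = 0`. -/
def torsionFree (τ : Pr A) : Set A :=
  {M | τ.arrow.app M = 0}

/-- The functor `L ↦ M ^ Hom(L, N)`. -/
@[simps]
def powHom [HasLimits A] (N M : A) : A ⥤ A where
  obj L := ∏ᶜ fun _ : L ⟶ N => M
  map {L _} g := Pi.lift fun f => Pi.π (fun _ : L ⟶ N => M) (g ≫ f)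
  map_id L := by
    apply Pi.hom_ext
    intro f
    rw [Pi.lift_π, Category.id_comp, Category.id_comp]
  map_comp g h := by
    apply Pi.hom_ext
    intro f
    rw [Pi.lift_π, Category.assoc, Category.assoc, Pi.lift_π, Pi.lift_π]

/-- For `k : N ⟶ M`, the natural transformation `L ⟶ M ^ Hom(L, N)` whose component at
`f : L ⟶ N` is `k ∘ f`. -/
@[simps]
def toPowHom [HasLimits A] {N M : A} (k : N ⟶ M) : 𝟭 A ⟶ powHom N M where
  app L := Pi.lift fun f : L ⟶ N => f ≫ k
  naturality L L' g := by
    have key : (g ≫ Pi.lift fun f : L' ⟶ N => f ≫ k) =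
        (Pi.lift fun f : L ⟶ N => f ≫ k) ≫
          Pi.lift fun f : L' ⟶ N => Pi.π (fun _ : L ⟶ N => M) (g ≫ f) := by
      apply Pi.hom_ext
      intro f
      rw [Category.assoc, Category.assoc, Pi.lift_π, Pi.lift_π, Pi.lift_π, Category.assoc]
    exact key

/-- The omega preradical `ω_k`, the kernel of `toPowHom k` in `A ⥤ A`. -/
def omega [HasLimits A] {N M : A} (k : N ⟶ M) : Pr A :=
  kernelSubobject (toPowHom k)

end

/-- The collection `Rad(A)` of radicals of `A`, with the order induced from `Pr(A)`. -/
abbrev Rad (A : Type u) [Category.{v} A] [Abelian A] : Type (max u v) :=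
  {σ : Pr A // IsRad σ}

end PreradicalLattice

end

open CategoryTheory CategoryTheory.Limits

namespace PreradicalLattice

/-! Everything is tested on torsion-free objects, those `M` with `τ_M = 0`. By `le_omega_iff`, `σ ≤
ω_{1_M}` says that every `L ⟶ M` kills `σ_L`. Always `(τ : τ) ≤ ω_{1_M}` for torsion-free `M`
(`prCoprod_le_omega`). If `τ` is a radical, each `L/τL` is torsion-free and `τ_L` is the kernel of
`L ⟶ L/τL`, so `τ` contains every common lower bound of these `ω_{1_M}` (`le_of_forall_le_omega`).
Meets of arbitrary classes exist because they are computed objectwise (`exists_isGLB`). -/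

lemma mk_factors_iff_exists {A : Type u} [Category.{v} A] {X Y W : A} (f : X ⟶ Y) [Mono f] (x : W ⟶ Y) :
    (Subobject.mk f).Factors x ↔ ∃ y : W ⟶ X, y ≫ f = x :=
  Subobject.mk_factors_iff f x

variable {A : Type u} [Category.{v} A] [Abelian A]

/-- Naturality of the objectwise factorizations is automatic because each `τ_L` is mono. -/
lemma pr_le_iff (σ τ : Pr A) :
    σ ≤ τ ↔ ∀ L : A, (Subobject.mk (τ.arrow.app L)).Factors (σ.arrow.app L) := by
  constructor
  · intro h L
    exact (mk_factors_iff_exists _ _).2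
      ⟨(Subobject.ofLE σ τ h).app L, congr_app (Subobject.ofLE_arrow h) L⟩
  · intro h
    choose y hy using fun L => (mk_factors_iff_exists _ _).1 (h L)
    refine Subobject.le_of_comm
      { app := y
        naturality := fun L L' g => ?_ } ?_
    · have hσ : ((σ : A ⥤ A).map g) ≫ σ.arrow.app L' = σ.arrow.app L ≫ g :=
        σ.arrow.naturality g
      have hτ : ((τ : A ⥤ A).map g) ≫ τ.arrow.app L' = τ.arrow.app L ≫ g :=
        τ.arrow.naturality g
      rw [← cancel_mono (τ.arrow.app L'), Category.assoc, Category.assoc, hy, hσ, hτ,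
        ← Category.assoc, hy]
    · ext L
      exact hy L

/-- The subfunctor of the identity given by a family of subobjects stable under all morphisms. -/
@[simps]
noncomputable def functorOfFamily (S : ∀ L : A, Subobject L)
    (hS : ∀ {L L' : A} (g : L ⟶ L'), (S L').Factors ((S L).arrow ≫ g)) : A ⥤ A where
  obj L := (S L : A)
  map {L L'} g := (S L').factorThru ((S L).arrow ≫ g) (hS g)
  map_id L := by simp
  map_comp {L L' L''} g h := by simp [← cancel_mono (S L'').arrow]

/-- The inclusion of `functorOfFamily` into the identity functor. -/
@[simps]
noncomputable def functorOfFamilyι (S : ∀ L : A, Subobject L)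
    (hS : ∀ {L L' : A} (g : L ⟶ L'), (S L').Factors ((S L).arrow ≫ g)) :
    functorOfFamily S hS ⟶ 𝟭 A where
  app L := (S L).arrow
  naturality _ L' g := (S L').factorThru_arrow _ (hS g)

instance (S : ∀ L : A, Subobject L)
    (hS : ∀ {L L' : A} (g : L ⟶ L'), (S L').Factors ((S L).arrow ≫ g)) :
    Mono (functorOfFamilyι S hS) := by
  rw [NatTrans.mono_iff_mono_app]
  intro L
  exact inferInstanceAs (Mono (S L).arrow)

lemma exists_pr_of_family (S : ∀ L : A, Subobject L)
    (hS : ∀ {L L' : A} (g : L ⟶ L'), (S L').Factors ((S L).arrow ≫ g)) :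
    ∃ τ : Pr A, ∀ L, Subobject.mk (τ.arrow.app L) = S L := by
  let e := Subobject.underlyingIso (functorOfFamilyι S hS)
  refine ⟨Subobject.mk (functorOfFamilyι S hS), fun L => ?_⟩
  refine (Subobject.mk_eq_mk_of_comm _ (S L).arrow (e.app L) ?_).trans (Subobject.mk_arrow _)
  exact congr_app (Subobject.underlyingIso_hom_comp_eq_mk (functorOfFamilyι S hS)) L

lemma exists_factors_iff_forall_factors [HasLimits A] [WellPowered.{v} A] {L : A}
    (s : Set (Subobject L)) :
    ∃ P : Subobject L, ∀ {W : A} (x : W ⟶ L), P.Factors x ↔ ∀ Q ∈ s, Q.Factors x := by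
  obtain ⟨P, hP⟩ : ∃ P, IsGLB s P :=
    ⟨Subobject.sInf.{v} s, Subobject.sInf_le.{v} s, Subobject.le_sInf.{v} s⟩
  refine ⟨P, fun {W} x =>
    ⟨fun h Q hQ => Subobject.factors_of_le x (hP.1 hQ) h, fun h => ?_⟩⟩
  -- The infimum property concerns subobjects only; the image of `x` extends it to arbitrary
  -- morphisms.
  have hle : imageSubobject x ≤ P := hP.2 fun Q hQ =>
    imageSubobject_le x (Q.factorThru x (h Q hQ)) (by simp)
  refine Subobject.factors_of_le x hle ?_
  simpa using imageSubobject_factors_comp_self (f := x) (𝟙 W)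

/-- However large `C` is, its values at `L` form a set of subobjects of `L`, whose infimum exists by
well-poweredness; these infima are stable under all morphisms. -/
lemma exists_isGLB [HasLimits A] [WellPowered.{v} A] (C : Set (Pr A)) :
    ∃ m : Pr A, IsGLB C m := by
  choose S hS using fun L : A => exists_factors_iff_forall_factors
    ((fun σ : Pr A => Subobject.mk (σ.arrow.app L)) '' C)
  obtain ⟨m, hm⟩ := exists_pr_of_family S (by
    intro L L' g
    rw [hS]
    rintro _ ⟨σ, hσ, rfl⟩
    obtain ⟨y, hy⟩ := (mk_factors_iff_exists _ _).1
      ((hS L _).1 (Subobject.factors_self (S L)) _ ⟨σ, hσ, rfl⟩)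
    have hg : ((σ : A ⥤ A).map g) ≫ σ.arrow.app L' = σ.arrow.app L ≫ g :=
      σ.arrow.naturality g
    refine (mk_factors_iff_exists _ _).2 ⟨y ≫ (σ : A ⥤ A).map g, ?_⟩
    rw [Category.assoc, hg, ← hy]
    exact (Category.assoc _ _ _).symm)
  refine ⟨m, fun σ hσ => (pr_le_iff _ _).2 fun L => ?_, fun σ hσ => (pr_le_iff _ _).2 fun L => ?_⟩
  · refine (hS L _).1 ?_ _ ⟨σ, hσ, rfl⟩
    rw [← hm L]
    exact Subobject.mk_factors_self _
  · rw [hm L, hS]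
    rintro _ ⟨ρ, hρ, rfl⟩
    exact (pr_le_iff _ _).1 (hσ hρ) L

lemma le_omega_iff [HasLimits A] (σ : Pr A) (M : A) :
    σ ≤ omega (𝟙 M) ↔ ∀ (L : A) (f : L ⟶ M), σ.arrow.app L ≫ f = 0 := by
  have key : σ ≤ omega (𝟙 M) ↔ σ.arrow ≫ toPowHom (𝟙 M) = 0 := by
    refine ⟨fun h => ?_, fun h => le_kernelSubobject _ _ h⟩
    have hk : (omega (𝟙 M)).arrow ≫ toPowHom (𝟙 M) = 0 := kernelSubobject_arrow_comp _
    rw [← Subobject.ofLE_arrow h, Category.assoc, hk, comp_zero]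
  have hcomp (L : A) (f : L ⟶ M) : (σ.arrow.app L ≫ Pi.lift fun f : L ⟶ M => f ≫ 𝟙 M) ≫
      Pi.π (fun _ : L ⟶ M => M) f = σ.arrow.app L ≫ f := by
    rw [Category.assoc, Pi.lift_π, Category.comp_id]
  rw [key]
  constructor
  · intro h L f
    have hL : (σ.arrow.app L ≫ Pi.lift fun f : L ⟶ M => f ≫ 𝟙 M) = 0 := congr_app h L
    rw [← hcomp, hL, zero_comp]
  · intro h
    ext L
    refine Pi.hom_ext _ _ fun f => ?_
    exact (hcomp L f).trans ((h L f).trans zero_comp.symm)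

lemma le_prCoprod (σ τ : Pr A) : σ ≤ prCoprod σ τ :=
  Subobject.le_mk_of_comm (Abelian.Preradical.toColon (rep σ) (rep τ)).hom.left
    (Over.w (Abelian.Preradical.toColon (rep σ) (rep τ)).hom)

lemma isRad_iff_le (σ : Pr A) : IsRad σ ↔ prCoprod σ σ ≤ σ :=
  ⟨fun h => h.le, fun h => le_antisymm h (le_prCoprod σ σ)⟩

lemma arrow_app_comp_eq_zero (τ : Pr A) {L M : A} (hM : M ∈ torsionFree τ) (f : L ⟶ M) :
    τ.arrow.app L ≫ f = 0 := by
  refine (τ.arrow.naturality f).symm.trans ?_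
  rw [show τ.arrow.app M = 0 from hM, comp_zero]

lemma le_omega [HasLimits A] (τ : Pr A) {M : A} (hM : M ∈ torsionFree τ) :
    τ ≤ omega (𝟙 M) :=
  (le_omega_iff τ M).2 fun _ f => arrow_app_comp_eq_zero τ hM f

/-- `f` kills `ΦL`, so it factors through `L/ΦL`; the colon lands there in `Φ(L/ΦL)`, which any map
to `M` kills. -/
lemma colon_ι_app_comp_eq_zero (Φ : Abelian.Preradical A) {L M : A} (hM : Φ.ι.app M = 0)
    (f : L ⟶ M) : (Φ.colon Φ).ι.app L ≫ f = 0 := by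
  have hΦ {N : A} (g : N ⟶ M) : Φ.ι.app N ≫ g = 0 := by
    refine (Φ.ι.naturality g).symm.trans ?_
    rw [hM, comp_zero]
  obtain ⟨f', hf'⟩ : ∃ f' : Φ.quotient.obj L ⟶ M, Φ.π.app L ≫ f' = f :=
    ⟨_, (CokernelCofork.IsColimit.desc' (Φ.isColimitCokernelCoforkObj L) f (hΦ f)).2⟩
  have h := Abelian.Preradical.colon_ι_app_π_app Φ Φ L =≫ f'
  have hz := (Φ.colonπ Φ).app L ≫= hΦ f'
  rw [← hf']
  exact (Category.assoc _ _ _).symm.trans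
    (h.trans ((Category.assoc _ _ _).trans (hz.trans comp_zero)))

lemma prCoprod_le_omega [HasLimits A] (τ : Pr A) {M : A} (hM : M ∈ torsionFree τ) :
    prCoprod τ τ ≤ omega (𝟙 M) := by
  refine (le_omega_iff _ M).2 fun L f => ?_
  have h := congr_app (Subobject.underlyingIso_hom_comp_eq_mk
    ((rep τ).colon (rep τ)).ι) L
  refine (h.symm =≫ f).trans ?_
  refine (Category.assoc _ _ _).trans ?_
  rw [colon_ι_app_comp_eq_zero (rep τ) hM f]
  exact comp_zero

lemma quotient_obj_mem_torsionFree {τ : Pr A} (hτ : IsRad τ) (L : A) :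
    (rep τ).quotient.obj L ∈ torsionFree τ := by
  have hle : Subobject.mk ((rep τ).colon (rep τ)).ι ≤ τ := (isRad_iff_le τ).1 hτ
  have hc : (Subobject.ofMkLE _ τ hle).app L ≫ τ.arrow.app L =
      ((rep τ).colon (rep τ)).ι.app L := congr_app (Subobject.ofMkLE_arrow hle) L
  have hπ : τ.arrow.app L ≫ (rep τ).π.app L = 0 := (rep τ).ι_π_app L
  have h0 : ((rep τ).colon (rep τ)).ι.app L ≫ (rep τ).π.app L = 0 := by
    rw [← hc]
    exact (Category.assoc _ _ _).trans (((_ : _ ⟶ _) ≫= hπ).trans comp_zero)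
  -- As a pullback of the epimorphism `L ⟶ L/τL`, this map can be cancelled, leaving `τ_{L/τL} = 0`.
  have : Epi (((rep τ).colonπ (rep τ)).app L) :=
    Abelian.Preradical.instEpiAppColonπ (rep τ) (rep τ) L
  exact zero_of_epi_comp (((rep τ).colonπ (rep τ)).app L)
    ((Abelian.Preradical.colon_ι_app_π_app (rep τ) (rep τ) L).symm.trans h0)

/-- A radical contains every preradical lying below all the `ω_{1_M}` with `M` torsion-free. -/
lemma le_of_forall_le_omega [HasLimits A] {σ τ : Pr A} (hτ : IsRad τ)
    (h : ∀ M ∈ torsionFree τ, σ ≤ omega (𝟙 M)) : σ ≤ τ := by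
  refine (pr_le_iff _ _).2 fun L => (Subobject.mk_factors_iff _ _).2 ?_
  have h0 := (le_omega_iff _ _).1 (h _ (quotient_obj_mem_torsionFree hτ L)) L ((rep τ).π.app L)
  obtain ⟨y, hy⟩ := KernelFork.IsLimit.lift' ((rep τ).isLimitKernelForkObj L) _ h0
  exact ⟨y, hy⟩

lemma torsionFree_anti {σ τ : Pr A} (h : σ ≤ τ) : torsionFree τ ⊆ torsionFree σ := by
  intro M hM
  have hM' : τ.arrow.app M = 0 := hM
  have hc := congr_app (Subobject.ofLE_arrow h) M
  change σ.arrow.app M = 0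
  rw [← hc, NatTrans.comp_app, hM', comp_zero]

lemma isRad_iff_eq_of_isGLB [HasLimits A] {τ m : Pr A}
    (hm : IsGLB {ω | ∃ M ∈ torsionFree τ, ω = omega (𝟙 M)} m) : IsRad τ ↔ τ = m := by
  constructor
  · intro hτ
    refine le_antisymm (hm.2 ?_) (le_of_forall_le_omega hτ fun M hM => hm.1 ⟨M, hM, rfl⟩)
    rintro _ ⟨M, hM, rfl⟩
    exact le_omega τ hM
  · intro h
    rw [isRad_iff_le]
    refine le_of_le_of_eq (hm.2 ?_) h.symm
    rintro _ ⟨M, hM, rfl⟩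
    exact prCoprod_le_omega τ hM

/-- For `σ ∈ C`, `m ≤ σ` makes every `σ`-torsion-free object `m`-torsion-free, so `(m : m)` lies
below the `ω_{1_M}` that cut out `σ`. -/
lemma isRad_of_isGLB [HasLimits A] {C : Set (Pr A)} (hC : ∀ σ ∈ C, IsRad σ) {m : Pr A}
    (hm : IsGLB C m) : IsRad m :=
  (isRad_iff_le m).2 <| hm.2 fun _ hσ => le_of_forall_le_omega (hC _ hσ) fun _ hM =>
    prCoprod_le_omega m (torsionFree_anti (hm.1 hσ) hM)

lemma exists_isGLB_rad [HasLimits A] [WellPowered.{v} A] (S : Set (Rad A)) :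
    ∃ m : Rad A, IsGLB S m := by
  obtain ⟨m, hm⟩ := exists_isGLB (Subtype.val '' S)
  have hrad : IsRad m := isRad_of_isGLB (by rintro _ ⟨σ, -, rfl⟩; exact σ.2) hm
  refine ⟨⟨m, hrad⟩, fun σ hσ => hm.1 ⟨σ, hσ, rfl⟩, fun σ hσ => hm.2 ?_⟩
  rintro _ ⟨ρ, hρ, rfl⟩
  exact hσ hρ

end PreradicalLattice

theorem proposition7p13 (A : Type u) [Category.{v} A] [Abelian A]
    [HasLimits A] [HasColimits A] [WellPowered.{v} A] :
    (∀ τ : PreradicalLattice.Pr A, ∃ m : PreradicalLattice.Pr A,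
      IsGLB {ω | ∃ M ∈ PreradicalLattice.torsionFree τ, ω = PreradicalLattice.omega (𝟙 M)} m ∧
      (PreradicalLattice.IsRad τ ↔ τ = m)) ∧
    (∀ C : Set (PreradicalLattice.Pr A), (∀ σ ∈ C, PreradicalLattice.IsRad σ) →
      ∃ m : PreradicalLattice.Pr A, IsGLB C m ∧ PreradicalLattice.IsRad m) ∧
    (∀ S : Set (PreradicalLattice.Rad A),
      (∃ j : PreradicalLattice.Rad A, IsLUB S j) ∧
      (∃ m : PreradicalLattice.Rad A, IsGLB S m)) := by
  refine ⟨fun τ => ?_, fun C hC => ?_, fun S => ⟨?_, PreradicalLattice.exists_isGLB_rad S⟩⟩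
  · obtain ⟨m, hm⟩ := PreradicalLattice.exists_isGLB
      {ω | ∃ M ∈ PreradicalLattice.torsionFree τ, ω = PreradicalLattice.omega (𝟙 M)}
    exact ⟨m, hm, PreradicalLattice.isRad_iff_eq_of_isGLB hm⟩
  · obtain ⟨m, hm⟩ := PreradicalLattice.exists_isGLB C
    exact ⟨m, hm, PreradicalLattice.isRad_of_isGLB hC hm⟩
  -- The join in `Rad` is the meet of all radical upper bounds.
  · obtain ⟨j, hj⟩ := PreradicalLattice.exists_isGLB_rad (upperBounds S)
    exact ⟨j, isGLB_upperBounds.1 hj⟩
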